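/- Fix an integer $m \ge 0$, proportions $0 < \theta_1 < \dots < \theta_m < 1$, levels $\mu_1, \dots, \mu_{m+1} \in \mathbb{R}$ with $\mu_k \neq \mu_{k+1}$ for $1 \le k \le m$, a number $\varepsilon > 0$ and a noise variance $\sigma^2$ with $0 < \sigma^2 < 1 + \varepsilon/2$ (for instance $\sigma^2 = 1$). For each $n$ put $\tau_i = \lfloor \theta_i n \rfloor$ for $1 \le i \le m$, $\tau_0 = 0$, $\tau_{m+1} = n$, and let $$Y_t = \epsilon_t + \mu_k \quad\text{for } \tau_{k-1} + 1 \le t \le \tau_k,\ 1 \le k \le m+1,$$ where $\epsilon_1, \dots, \epsilon_n$ are independent $N(0, \sigma^2)$ random variables. Let $0 < \hat\tau_1 < \dots < \hat\tau_{\hat m} < n$ be an output of PELT with squared error loss and penalty $\beta = (2 + \varepsilon) \log n$, that is, any global minimiser, over all $m' \ge 0$ and all integers $0 = t_0 < t_1 < \dots < t_{m'} < t_{m'+1} = n$, of the penalised cost $$\sum_{j=1}^{m'+1} \Bigl[ \sum_{i = t_{j-1}+1}^{t_j} \bigl( Y_i - \bar Y_{t_{j-1}+1 : t_j} \bigr)^2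 + \beta \Bigr],$$ where $\bar Y_{a+1:b}$ is the average of $Y_{a+1}, \dots, Y_b$; no upper bound on the number $m'$ of changes is imposed. Then for every $\alpha > 0$, as $n \to \infty$, $$\mathbb{P}\Bigl( \hat m = m \ \text{ and } \ \max_{1 \le i \le m} |\hat\tau_i - \tau_i| \le \bigl\lceil (\log n)^{1+\alpha} \bigr\rceil \ \text{ for every such minimiser} \Bigr) \longrightarrow 1 .$$ -/

import Mathlib

open MeasureTheory ProbabilityTheory Filter Topology
open scoped NNReal ENNReal

namespace Changepoint

/-- A segmentation of the time points `1, …, n`: finitely many changepoints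
`0 < loc 0 < loc 1 < … < loc (num - 1) < n`.  The number `num` of changepoints is not bounded
a priori. -/
structure Segmentation (n : ℕ) where
  /-- number of changepoints -/
  num : ℕ
  /-- locations of the changepoints, in increasing order -/
  loc : Fin num → ℕ
  strictMono : StrictMono loc
  pos : ∀ i, 0 < loc i
  lt : ∀ i, loc i < n

/-- The boundary points `0 = τ₀, τ₁, …, τ_k, τ_{k+1} = n` attached to the
changepoints `τ₁, …, τ_k`. -/
def boundary (n : ℕ) {k : ℕ} (τ : Fin k → ℕ) : Fin (k + 2) → ℕ :=
  Fin.cons (α := fun _ => ℕ) 0 (Fin.snoc (α := fun _ => ℕ) τ n)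

/-- Quadratic error loss of the data `y (a+1), …, y b`, fitted by their average. -/
noncomputable def segmentCost (y : ℕ → ℝ) (a b : ℕ) : ℝ :=
  ∑ i ∈ Finset.Ioc a b, (y i - (∑ j ∈ Finset.Ioc a b, y j) / ((b : ℝ) - (a : ℝ))) ^ 2

/-- Penalised cost of a segmentation of `y 1, …, y n`: each segment
`y (τ_j + 1), …, y τ_{j+1}` contributes its quadratic error loss plus the penalty `β`. -/
noncomputable def penalisedCost {n : ℕ} (y : ℕ → ℝ) (β : ℝ) (s : Segmentation n) : ℝ :=
  ∑ j : Fin (s.num + 1),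
    (segmentCost y (boundary n s.loc j.castSucc) (boundary n s.loc j.succ) + β)

/-- `s` is a possible output of PELT (an exact minimiser of the penalised cost over all
segmentations, with any number of changepoints) for the data `y 1, …, y n` and penalty `β`. -/
def IsPELTOutput {n : ℕ} (y : ℕ → ℝ) (β : ℝ) (s : Segmentation n) : Prop :=
  ∀ s' : Segmentation n, penalisedCost y β s ≤ penalisedCost y β s'

/-- The changepoints `τ_i = ⌊θ_i n⌋` of a series of length `n`. -/
noncomputable def trueChange {m : ℕ} (θ : Fin m → ℝ) (n : ℕ) (i : Fin m) : ℕ :=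
  ⌊θ i * (n : ℝ)⌋₊

/-- The piecewise constant mean with levels `μ 0, …, μ m` and changepoints `τ`: the level at
time `t` is `μ k`, where `k` is the number of changepoints strictly before `t`. -/
noncomputable def signal {m : ℕ} (μ : Fin (m + 1) → ℝ) (τ : Fin m → ℕ) (t : ℕ) : ℝ :=
  μ ⟨(Finset.univ.filter fun i : Fin m => τ i < t).card,
    Nat.lt_succ_of_le ((Finset.card_filter_le _ _).trans (Finset.card_fin m).le)⟩

/-- The segmentation `s` has exactly `m` changepoints, and the `i`-th of them is within
distance `r` of `τ i` for every `i`. -/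
def Accurate {n m : ℕ} (τ : Fin m → ℕ) (r : ℤ) (s : Segmentation n) : Prop :=
  ∃ h : m = s.num, ∀ i : Fin m, |((s.loc (Fin.cast h i) : ℕ) : ℤ) - (τ i : ℤ)| ≤ r

/-- On the segment `τ_k < t ≤ τ_{k+1}` the mean is the `k`-th level. -/
theorem signal_eq {m n : ℕ} (μ : Fin (m + 1) → ℝ) (τ : Fin m → ℕ) (hτ : Monotone τ)
    (k : Fin (m + 1)) (t : ℕ) (h₁ : boundary n τ k.castSucc < t)
    (h₂ : t ≤ boundary n τ k.succ) : signal μ τ t = μ k := by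
  unfold signal
  congr 1
  apply Fin.ext
  have key : ∀ i : Fin m, τ i < t ↔ i.val < k.val := by
    intro i
    constructor
    · intro hi
      by_contra hk
      have hkm : k.val < m := by omega
      have e : boundary n τ k.succ = τ ⟨k.val, hkm⟩ := by
        have : k.succ = (⟨k.val, hkm⟩ : Fin m).castSucc.succ := Fin.ext rfl
        rw [this]
        simp only [boundary, Fin.cons_succ, Fin.snoc_castSucc]
      have : τ ⟨k.val, hkm⟩ ≤ τ i := hτ (by simp only [Fin.le_def]; omega)
      omega
    · intro hi
      have hkm : k.val - 1 < m := by omega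
      have e : boundary n τ k.castSucc = τ ⟨k.val - 1, hkm⟩ := by
        have : k.castSucc = (⟨k.val - 1, hkm⟩ : Fin m).castSucc.succ := by
          apply Fin.ext
          simp
          omega
        rw [this]
        simp only [boundary, Fin.cons_succ, Fin.snoc_castSucc]
      have : τ i ≤ τ ⟨k.val - 1, hkm⟩ := hτ (by simp only [Fin.le_def]; omega)
      omega
  simp only [key]
  have : k.val ≤ m := by omega
  rw [Fin.card_filter_val_lt]
  exact Nat.min_eq_right this

/-- There are only finitely many segmentations of a series of length `n`. -/
theorem finite_segmentation (n : ℕ) : Finite (Segmentation n) := by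
  let f : Segmentation n → Finset (Fin n) := fun s =>
    Finset.univ.image fun i => (⟨s.loc i, s.lt i⟩ : Fin n)
  refine Finite.of_injective f ?_
  rintro ⟨k, l, hm, hp, hl⟩ ⟨k', l', hm', hp', hl'⟩ h
  have hr : Set.range l = Set.range l' := by
    ext x
    have := fun y : Fin n => Finset.ext_iff.1 h y
    simp only [f, Finset.mem_image, Finset.mem_univ, true_and, Fin.ext_iff] at this
    constructor
    · rintro ⟨i, rfl⟩
      exact (this ⟨l i, hl i⟩).1 ⟨i, rfl⟩
    · rintro ⟨i, rfl⟩
      exact (this ⟨l' i, hl' i⟩).2 ⟨i, rfl⟩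
  have hk : k = k' := by
    have h1 := Set.ncard_range_of_injective hm.injective
    have h2 := Set.ncard_range_of_injective hm'.injective
    rw [hr, h2] at h1
    simpa using h1.symm
  subst hk
  have : l = l' := (StrictMono.range_inj hm hm').1 hr
  subst this
  rfl

/-- PELT always has an output. -/
theorem exists_isPELTOutput (n : ℕ) (y : ℕ → ℝ) (β : ℝ) :
    ∃ s : Segmentation n, IsPELTOutput y β s := by
  have := finite_segmentation n
  have : Nonempty (Segmentation n) :=
    ⟨⟨0, Fin.elim0, fun i => i.elim0, fun i => i.elim0, fun i => i.elim0⟩⟩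
  exact Finite.exists_min (penalisedCost y β)

end Changepoint

/-!
The proof compares a minimiser `S`, viewed as a finite set of changepoints, with two competitors.
Throughout, `z` is the noise, `f` the signal, `R = ⌈(log n) ^ (1 + α)⌉`, and the loss of a
segmentation is the squared distance of the data to the functions constant on its segments, so that
refining a segmentation does not increase the loss.

*No jump is missed.* If `S` has no point within `R` of a true changepoint `τ`, its fit is constant on
`(τ - R, τ + R]`. Adding `τ - R`, `τ` and `τ + R` costs three penalties, of order `log n`, and, as
soon as the noise sums on `(τ - R, τ]` and `(τ, τ + R]` are small compared to `R`, gains a multiple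
of `R` (`IsOptimal.exists_near`). Only finitely many noise sums occur here, one pair for each jump.

*No spurious changepoint.* Otherwise choose a point `a i` of `S` near each `τ i`, and let `B` be the
nonempty set of the remaining points of `S`. Comparing `S` with the true segmentation `T`, whose
loss is at most `∑ z ^ 2`, and bounding the loss of `S` below by that of the common refinement
`U = T ∪ S`, on whose segments `f` is constant, shows that the energy `∑ (∑ z) ^ 2 / length` of the
noise on the segments of `U` is at least `#B * β` (`IsOptimal.excess_mul_le_blockEnergy`). This
energy is `v` times a chi-squared variable with at most `2 * m + 1 + #B` degrees of freedom, so for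
`l < 1 / 2` the event has probability at most `C ^ (2 * m + 1 + #B) * exp (-l * #B * β / v)`
(`measure_le_blockEnergy`). Since `β = (2 + ε) * log n` and `v < 1 + ε / 2`, some `l < 1 / 2` makes
the exponential equal to `n ^ (-p * #B)` with `p > 1`. There are `(2 * R + 1) ^ m` choices of `a`,
a power of `log n`, and at most `n ^ k` sets `B` with `k` elements, so the union bound
(`measure_exists_le_blockEnergy`) is of order `(2 * R + 1) ^ m * n ^ (1 - p)`, which tends to `0`.
Counting the points near the `τ i` separately is essential: they are as numerous as the `τ i` even
when `#B = 1`, and must not cost a factor `n` each.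

On the remaining event `S` has exactly `m` points, one near each `τ i`, in the right order.
-/

namespace Changepoint

/-! ### Residual sums of squares of labelled data -/

/-- Residual sum of squares of the data `y t`, `t ∈ I`, when each class `{t ∈ I | c t = k}` of the
labelling `c` is fitted by its average. -/
noncomputable def rss (I : Finset ℕ) (y : ℕ → ℝ) (c : ℕ → ℕ) : ℝ :=
  ∑ t ∈ I, (y t - (∑ u ∈ I with c u = c t, y u) / (I.filter fun u => c u = c t).card) ^ 2

/-- The squared norm of the projection of `z` onto the functions that are constant on each of the
(disjoint) blocks `B k`, `k ∈ K`, and vanish elsewhere. -/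
noncomputable def blockEnergy {ι κ : Type*} (K : Finset κ) (B : κ → Finset ι) (z : ι → ℝ) : ℝ :=
  ∑ k ∈ K, (∑ t ∈ B k, z t) ^ 2 / (B k).card

theorem sum_sub_average_sq (F : Finset ℕ) (y : ℕ → ℝ) (a : ℝ) :
    ∑ t ∈ F, (y t - (∑ u ∈ F, y u) / F.card) ^ 2 =
      ∑ t ∈ F, (y t - a) ^ 2 - F.card * ((∑ u ∈ F, y u) / F.card - a) ^ 2 := by
  rcases F.eq_empty_or_nonempty with rfl | hF
  · simp
  have hc : (F.card : ℝ) ≠ 0 := by exact_mod_cast hF.card_pos.ne'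
  set A := (∑ u ∈ F, y u) / F.card with hA
  have hS : ∑ u ∈ F, y u = F.card * A := by rw [hA]; field_simp
  have h : ∀ b : ℝ, ∑ t ∈ F, (y t - b) ^ 2 = ∑ t ∈ F, y t ^ 2 - 2 * b * (F.card * A)
      + F.card * b ^ 2 := by
    intro b
    rw [← hS, Finset.mul_sum, ← nsmul_eq_mul, ← Finset.sum_const, ← Finset.sum_sub_distrib,
      ← Finset.sum_add_distrib]
    exact Finset.sum_congr rfl fun t _ => by ring
  rw [h, h]
  ring

theorem rss_eq_sum_fiber {I K : Finset ℕ} (y : ℕ → ℝ) {c : ℕ → ℕ} (hc : ∀ t ∈ I, c t ∈ K) :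
    rss I y c = ∑ k ∈ K, ∑ t ∈ I with c t = k,
      (y t - (∑ u ∈ I with c u = k, y u) / (I.filter fun u => c u = k).card) ^ 2 := by
  unfold rss
  rw [← Finset.sum_fiberwise_of_maps_to hc]
  refine Finset.sum_congr rfl fun k _ => Finset.sum_congr rfl fun t ht => ?_
  rw [(Finset.mem_filter.1 ht).2]

/-- Class averages are the best fit among all functions constant on the classes. -/
theorem rss_le_sum_sq {I : Finset ℕ} (y : ℕ → ℝ) {c : ℕ → ℕ} {h : ℕ → ℝ}
    (hh : ∀ t ∈ I, ∀ u ∈ I, c t = c u → h t = h u) :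
    rss I y c ≤ ∑ t ∈ I, (y t - h t) ^ 2 := by
  have hc : ∀ t ∈ I, c t ∈ I.image c := fun t ht => Finset.mem_image_of_mem c ht
  rw [rss_eq_sum_fiber y hc, ← Finset.sum_fiberwise_of_maps_to hc]
  refine Finset.sum_le_sum fun k hk => ?_
  obtain ⟨t₀, ht₀, rfl⟩ := Finset.mem_image.1 hk
  have : ∑ t ∈ I with c t = c t₀, (y t - h t) ^ 2 = ∑ t ∈ I with c t = c t₀, (y t - h t₀) ^ 2 :=
    Finset.sum_congr rfl fun t ht => by
      rw [hh t (Finset.mem_filter.1 ht).1 t₀ ht₀ (Finset.mem_filter.1 ht).2]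
  rw [this, sum_sub_average_sq _ y (h t₀)]
  have : (0 : ℝ) ≤ (I.filter fun u => c u = c t₀).card *
      ((∑ u ∈ I with c u = c t₀, y u) / (I.filter fun u => c u = c t₀).card - h t₀) ^ 2 := by
    positivity
  linarith

theorem rss_anti {I : Finset ℕ} (y : ℕ → ℝ) {c c' : ℕ → ℕ}
    (h : ∀ t ∈ I, ∀ u ∈ I, c' t = c' u → c t = c u) : rss I y c' ≤ rss I y c :=
  rss_le_sum_sq y fun t ht u hu htu => by rw [h t ht u hu htu]

theorem rss_add {I : Finset ℕ} (z : ℕ → ℝ) {c : ℕ → ℕ} {f : ℕ → ℝ}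
    (hf : ∀ t ∈ I, ∀ u ∈ I, c t = c u → f t = f u) :
    rss I (fun t => z t + f t) c = rss I z c := by
  unfold rss
  refine Finset.sum_congr rfl fun t ht => ?_
  have hcard : ((I.filter fun u => c u = c t).card : ℝ) ≠ 0 := by
    have hmem : t ∈ I.filter fun u => c u = c t := Finset.mem_filter.2 ⟨ht, rfl⟩
    exact_mod_cast (Finset.card_pos.2 ⟨t, hmem⟩).ne'
  have : ∑ u ∈ I with c u = c t, (z u + f u) =
      ∑ u ∈ I with c u = c t, z u + (I.filter fun u => c u = c t).card * f t := by
    rw [Finset.sum_add_distrib, ← nsmul_eq_mul, ← Finset.sum_const]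
    congr 1
    exact Finset.sum_congr rfl fun u hu =>
      hf u (Finset.mem_filter.1 hu).1 t ht (Finset.mem_filter.1 hu).2
  rw [this]
  congr 1
  field_simp
  ring

/-- Pythagoras for the projection onto the functions constant on the classes of `c`. -/
theorem rss_eq_sub_blockEnergy {I K : Finset ℕ} (z : ℕ → ℝ) {c : ℕ → ℕ} (hc : ∀ t ∈ I, c t ∈ K) :
    rss I z c = ∑ t ∈ I, z t ^ 2 - blockEnergy K (fun k => I.filter fun t => c t = k) z := by
  rw [rss_eq_sum_fiber z hc, ← Finset.sum_fiberwise_of_maps_to hc, blockEnergy,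
    ← Finset.sum_sub_distrib]
  refine Finset.sum_congr rfl fun k _ => ?_
  rw [sum_sub_average_sq _ z 0]
  simp only [sub_zero]
  congr 1
  rcases (I.filter fun t => c t = k).eq_empty_or_nonempty with h | h
  · simp [h]
  · have : ((I.filter fun t => c t = k).card : ℝ) ≠ 0 := by exact_mod_cast h.card_pos.ne'
    field_simp

/-! ### Segmentations as finite sets of changepoints -/

/-- The number of changepoints in `S` strictly before `t`, which numbers the segments. -/
def segmentLabel (S : Finset ℕ) (t : ℕ) : ℕ := (S.filter fun x => x < t).card

theorem segmentLabel_eq_iff {S : Finset ℕ} {t u : ℕ} :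
    segmentLabel S t = segmentLabel S u ↔ ∀ x ∈ S, (x < t ↔ x < u) := by
  have key : ∀ {a b : ℕ}, a ≤ b → segmentLabel S a = segmentLabel S b →
      ∀ x ∈ S, (x < a ↔ x < b) := by
    intro a b hab h x hx
    have hsub : (S.filter fun x => x < a) ⊆ S.filter fun x => x < b := fun x hx => by
      simp only [Finset.mem_filter] at hx ⊢
      exact ⟨hx.1, hx.2.trans_le hab⟩
    have := Finset.ext_iff.1 (Finset.eq_of_subset_of_card_le hsub h.ge) x
    simpa [hx] using this
  constructor
  · intro h
    rcases le_total t u with htu | hut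
    · exact key htu h
    · exact fun x hx => (key hut h.symm x hx).symm
  · intro h
    unfold segmentLabel
    rw [Finset.filter_congr h]

theorem segmentLabel_le_card (S : Finset ℕ) (t : ℕ) : segmentLabel S t ≤ S.card :=
  Finset.card_filter_le _ _

theorem rss_segmentLabel_anti (I : Finset ℕ) (y : ℕ → ℝ) {S S' : Finset ℕ} (h : S ⊆ S') :
    rss I y (segmentLabel S') ≤ rss I y (segmentLabel S) :=
  rss_anti y fun _ _ _ _ htu =>
    segmentLabel_eq_iff.2 fun x hx => segmentLabel_eq_iff.1 htu x (h hx)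

theorem signal_eq_of_segmentLabel_eq {m : ℕ} (μ : Fin (m + 1) → ℝ) {τ : Fin m → ℕ} {S : Finset ℕ}
    (hS : ∀ i, τ i ∈ S) {t u : ℕ} (h : segmentLabel S t = segmentLabel S u) :
    signal μ τ t = signal μ τ u := by
  unfold signal
  congr 2
  exact congrArg Finset.card
    (Finset.filter_congr fun i _ => segmentLabel_eq_iff.1 h (τ i) (hS i))

/-- The set of changepoints of a segmentation. -/
def Segmentation.toFinset {n : ℕ} (s : Segmentation n) : Finset ℕ := Finset.univ.image s.loc

theorem Segmentation.card_toFinset {n : ℕ} (s : Segmentation n) : s.toFinset.card = s.num := by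
  rw [toFinset, Finset.card_image_of_injective _ s.strictMono.injective, Finset.card_fin]

theorem Segmentation.toFinset_subset {n : ℕ} (s : Segmentation n) :
    s.toFinset ⊆ Finset.Ioo 0 n := by
  intro x hx
  obtain ⟨i, -, rfl⟩ := Finset.mem_image.1 hx
  exact Finset.mem_Ioo.2 ⟨s.pos i, s.lt i⟩

theorem exists_segmentation_toFinset {n : ℕ} {S : Finset ℕ} (hS : S ⊆ Finset.Ioo 0 n) :
    ∃ s : Segmentation n, s.toFinset = S :=
  ⟨⟨S.card, S.orderEmbOfFin rfl, (S.orderEmbOfFin rfl).strictMono,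
    fun i => (Finset.mem_Ioo.1 (hS (S.orderEmbOfFin_mem rfl i))).1,
    fun i => (Finset.mem_Ioo.1 (hS (S.orderEmbOfFin_mem rfl i))).2⟩,
    S.image_orderEmbOfFin_univ rfl⟩

theorem Segmentation.segmentLabel_toFinset {n : ℕ} (s : Segmentation n) (t : ℕ) :
    segmentLabel s.toFinset t = (Finset.univ.filter fun i => s.loc i < t).card := by
  rw [segmentLabel, toFinset, Finset.filter_image,
    Finset.card_image_of_injective _ s.strictMono.injective]

theorem Segmentation.loc_lt_iff {n : ℕ} (s : Segmentation n) (i : Fin s.num) (t : ℕ) :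
    s.loc i < t ↔ i.val < (Finset.univ.filter fun j => s.loc j < t).card := by
  constructor
  · intro h
    have hsub : Finset.Iic i ⊆ Finset.univ.filter fun j => s.loc j < t := fun j hj => by
      simpa using (s.strictMono.monotone (Finset.mem_Iic.1 hj)).trans_lt h
    simpa using Finset.card_le_card hsub
  · intro h
    by_contra hi
    have hsub : (Finset.univ.filter fun j => s.loc j < t) ⊆ Finset.Iio i := fun j hj => by
      have := (Finset.mem_filter.1 hj).2
      exact Finset.mem_Iio.2 (s.strictMono.lt_iff_lt.1 (by omega))
    have := Finset.card_le_card hsub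
    rw [Fin.card_Iio] at this
    omega

theorem Segmentation.filter_segmentLabel {n : ℕ} (s : Segmentation n) (k : Fin (s.num + 1)) :
    ((Finset.Icc 1 n).filter fun t => segmentLabel s.toFinset t = k) =
      Finset.Ioc (boundary n s.loc k.castSucc) (boundary n s.loc k.succ) := by
  ext t
  rw [Finset.mem_filter, Finset.mem_Ioc, Finset.mem_Icc, s.segmentLabel_toFinset]
  constructor
  · rintro ⟨⟨ht1, htn⟩, hk⟩
    have lt_iff : ∀ i, s.loc i < t ↔ i.val < k.val := fun i => s.loc_lt_iff i t |>.trans (by rw [hk])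
    constructor
    · rcases Fin.eq_zero_or_eq_succ k with rfl | ⟨i, rfl⟩
      · simpa [boundary] using Nat.pos_of_ne_zero (by omega : t ≠ 0)
      · have : boundary n s.loc i.succ.castSucc = s.loc i := by
          rw [← Fin.succ_castSucc]
          simp only [boundary, Fin.cons_succ, Fin.snoc_castSucc]
        rw [this, lt_iff]
        simp
    · rcases Fin.eq_castSucc_or_eq_last k with ⟨i, rfl⟩ | rfl
      · have : boundary n s.loc i.castSucc.succ = s.loc i := by
          simp only [boundary, Fin.cons_succ, Fin.snoc_castSucc]
        rw [this, ← not_lt, lt_iff]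
        simp
      · simpa [boundary] using htn
  · rintro ⟨h1, h2⟩
    have hk := signal_eq (fun k => (k.val : ℝ)) s.loc s.strictMono.monotone k t h1 h2
    refine ⟨⟨by omega, h2.trans ?_⟩, ?_⟩
    · rcases Fin.eq_castSucc_or_eq_last k with ⟨i, rfl⟩ | rfl
      · simp only [boundary, Fin.cons_succ, Fin.snoc_castSucc]
        exact (s.lt i).le
      · simp [boundary]
    · simpa [signal] using hk

theorem penalisedCost_eq_rss {n : ℕ} (y : ℕ → ℝ) (β : ℝ) (s : Segmentation n) :
    penalisedCost y β s =
      rss (Finset.Icc 1 n) y (segmentLabel s.toFinset) + (s.toFinset.card + 1) * β := by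
  have hK : ∀ t ∈ Finset.Icc 1 n, segmentLabel s.toFinset t ∈ Finset.range (s.num + 1) :=
    fun t _ => Finset.mem_range.2
      (Nat.lt_succ_of_le ((segmentLabel_le_card _ _).trans s.card_toFinset.le))
  rw [rss_eq_sum_fiber y hK, Finset.sum_range, penalisedCost, Finset.sum_add_distrib,
    s.card_toFinset]
  congr 1
  · refine Finset.sum_congr rfl fun k _ => ?_
    rw [s.filter_segmentLabel k, segmentCost, Nat.card_Ioc]
    rcases le_total (boundary n s.loc k.castSucc) (boundary n s.loc k.succ) with h | h
    · rw [Nat.cast_sub h]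
    · simp [Finset.Ioc_eq_empty_of_le h]
  · simp

/-! ### Tails of the energy of Gaussian noise on disjoint blocks -/

theorem blockEnergy_subtype {ι κ : Type*} [DecidableEq ι] {K : Finset κ} {B : κ → Finset ι}
    {U : Finset ι} (h : ∀ k ∈ K, B k ⊆ U) (z : ι → ℝ) :
    blockEnergy K (fun k => (B k).subtype (· ∈ U)) (fun i : U => z i) = blockEnergy K B z := by
  refine Finset.sum_congr rfl fun k hk => ?_
  rw [Finset.sum_subtype_of_mem z fun x hx => h k hk hx, Finset.card_subtype,
    Finset.filter_true_of_mem fun x hx => h k hk hx]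

theorem measurable_blockEnergy {ι κ : Type*} (K : Finset κ) (B : κ → Finset ι) :
    Measurable (blockEnergy K B) := by
  unfold blockEnergy
  fun_prop

/-- The exponential moment `E exp (l g ^ 2)` of the square of a standard Gaussian variable `g`. -/
noncomputable def expSqMoment (l : ℝ) : ℝ≥0∞ :=
  ∫⁻ x, ENNReal.ofReal (Real.exp (l * x ^ 2)) ∂(gaussianReal 0 1)

theorem expSqMoment_ne_top {l : ℝ} (hl : l < 1 / 2) : expSqMoment l ≠ ∞ := by
  have h : Integrable (fun x : ℝ => (√(2 * Real.pi))⁻¹ * Real.exp (-(1 / 2 - l) * x ^ 2)) :=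
    (integrable_exp_neg_mul_sq (by linarith)).const_mul _
  rw [expSqMoment, gaussianReal_of_var_ne_zero 0 one_ne_zero,
    lintegral_withDensity_eq_lintegral_mul₀ (measurable_gaussianPDF 0 1).aemeasurable
      (by fun_prop)]
  refine ne_of_eq_of_ne (lintegral_congr fun x => ?_) h.lintegral_lt_top.ne
  rw [Pi.mul_apply, gaussianPDF, ← ENNReal.ofReal_mul (gaussianPDFReal_nonneg _ _ _),
    gaussianPDFReal, mul_assoc, ← Real.exp_add]
  congr 3
  · simp
  · simp; ring

theorem one_le_expSqMoment {l : ℝ} (hl : 0 ≤ l) : 1 ≤ expSqMoment l := by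
  calc (1 : ℝ≥0∞) = ∫⁻ _, 1 ∂(gaussianReal 0 1) := by simp
    _ ≤ expSqMoment l := lintegral_mono fun x =>
        ENNReal.one_le_ofReal.2 (Real.one_le_exp (by positivity))

section Noise

variable {Ω ι κ : Type*} [MeasurableSpace Ω] {P : Measure Ω} {X : ι → Ω → ℝ} {v : ℝ≥0}

theorem map_sum_gaussianReal [IsProbabilityMeasure P] (hlaw : ∀ i, HasLaw (X i) (gaussianReal 0 v) P)
    (hindep : iIndepFun X P) (F : Finset ι) :
    P.map (∑ i ∈ F, X i) = gaussianReal 0 (F.card * v) := by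
  induction F using Finset.cons_induction with
  | empty =>
    simp only [Finset.sum_empty, Finset.card_empty, Nat.cast_zero, zero_mul, gaussianReal_zero_var]
    exact (Measure.map_const P (0 : ℝ)).trans (by simp)
  | cons a F ha ih =>
    have hi := hindep.indepFun_finsetSum_of_notMem₀ (fun i => (hlaw i).aemeasurable) ha
    rw [Finset.sum_cons, add_comm,
      gaussianReal_add_gaussianReal_of_indepFun hi ih (hlaw a).map_eq]
    congr 1
    · simp
    · rw [Finset.card_cons]; push_cast; ring

theorem lintegral_exp_sq_sum_div_card [IsProbabilityMeasure P] {l : ℝ} (hl : 0 ≤ l) (hv : 0 < v)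
    (hlaw : ∀ i, HasLaw (X i) (gaussianReal 0 v) P) (hindep : iIndepFun X P) (F : Finset ι) :
    ∫⁻ ω, ENNReal.ofReal (Real.exp (l / v * ((∑ i ∈ F, X i ω) ^ 2 / F.card))) ∂P
      ≤ expSqMoment l := by
  rcases F.eq_empty_or_nonempty with rfl | hF
  · simpa using one_le_expSqMoment hl
  have hc : (0 : ℝ) < F.card := by exact_mod_cast hF.card_pos
  have hv' : (0 : ℝ) < v := hv
  have hmap := map_sum_gaussianReal hlaw hindep F
  have hae : AEMeasurable (∑ i ∈ F, X i) P :=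
    Finset.aemeasurable_sum _ fun i _ => (hlaw i).aemeasurable
  have h1 : ∫⁻ ω, ENNReal.ofReal (Real.exp (l / v * ((∑ i ∈ F, X i ω) ^ 2 / F.card))) ∂P =
      ∫⁻ x, ENNReal.ofReal (Real.exp (l / v * (x ^ 2 / F.card))) ∂(P.map (∑ i ∈ F, X i)) := by
    rw [lintegral_map' (by fun_prop) hae]
    simp only [Finset.sum_apply]
  have h2 : gaussianReal 0 (F.card * v) =
      (gaussianReal 0 1).map (fun x => √(F.card * v) * x) := by
    rw [gaussianReal_map_const_mul]
    congr 1
    · simp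
    · ext
      simp [mul_pow]
  rw [h1, hmap, h2, lintegral_map (by fun_prop) (by fun_prop), expSqMoment]
  refine le_of_eq (lintegral_congr fun x => ?_)
  rw [mul_pow, Real.sq_sqrt (by positivity)]
  congr 2
  field_simp

/-- The energies of the noise on disjoint blocks are independent, and each of them is `v` times the
square of a standard Gaussian variable (or zero, when the block is empty). -/
theorem lintegral_exp_blockEnergy_le [IsProbabilityMeasure P] {l : ℝ} (hl : 0 ≤ l) (hv : 0 < v)
    (hlaw : ∀ i, HasLaw (X i) (gaussianReal 0 v) P) (hindep : iIndepFun X P)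
    (K : Finset κ) {B : κ → Finset ι} (hB : (K : Set κ).PairwiseDisjoint B) :
    ∫⁻ ω, ENNReal.ofReal (Real.exp (l / v * blockEnergy K B fun i => X i ω)) ∂P
      ≤ expSqMoment l ^ K.card := by
  classical
  induction K using Finset.cons_induction with
  | empty => simp [blockEnergy]
  | cons a K ha ih =>
    have hB' : (K : Set κ).PairwiseDisjoint B := hB.subset (by simp)
    have hdisj : Disjoint (B a) (K.biUnion B) := by
      rw [Finset.disjoint_biUnion_right]
      intro k hk
      exact hB (by simp) (by simp [hk]) (by rintro rfl; exact ha hk)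
    have hi := hindep.indepFun_finset₀ (B a) (K.biUnion B) hdisj fun i => (hlaw i).aemeasurable
    have hm : ∀ (κ' ι' : Type _) (K' : Finset κ') (B' : κ' → Finset ι'), Measurable
        fun z => ENNReal.ofReal (Real.exp (l / v * blockEnergy K' B' z)) := fun _ _ K' B' =>
      ((measurable_blockEnergy K' B').const_mul _).exp.ennreal_ofReal
    have hi' := hi.comp (hm κ _ {a} fun k => (B k).subtype (· ∈ B a))
      (hm κ _ K fun k => (B k).subtype (· ∈ K.biUnion B))
    have e1 : ((fun z => ENNReal.ofReal (Real.exp (l / v *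
          blockEnergy {a} (fun k => (B k).subtype (· ∈ B a)) z))) ∘ fun ω (i : B a) => X i ω) =
        fun ω => ENNReal.ofReal (Real.exp (l / v * ((∑ i ∈ B a, X i ω) ^ 2 / (B a).card))) := by
      funext ω
      simp only [Function.comp]
      rw [blockEnergy_subtype (by simp) fun i => X i ω]
      simp [blockEnergy]
    have e2 : ((fun z => ENNReal.ofReal (Real.exp (l / v *
          blockEnergy K (fun k => (B k).subtype (· ∈ K.biUnion B)) z))) ∘
          fun ω (i : K.biUnion B) => X i ω) =
        fun ω => ENNReal.ofReal (Real.exp (l / v * blockEnergy K B fun i => X i ω)) := by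
      funext ω
      simp only [Function.comp]
      rw [blockEnergy_subtype (fun k hk => Finset.subset_biUnion_of_mem B hk) fun i => X i ω]
    rw [e1, e2] at hi'
    have hX : ∀ i, AEMeasurable (X i) P := fun i => (hlaw i).aemeasurable
    calc ∫⁻ ω, ENNReal.ofReal
          (Real.exp (l / v * blockEnergy (Finset.cons a K ha) B fun i => X i ω)) ∂P
        = ∫⁻ ω, ENNReal.ofReal (Real.exp (l / v * ((∑ i ∈ B a, X i ω) ^ 2 / (B a).card))) *
            ENNReal.ofReal (Real.exp (l / v * blockEnergy K B fun i => X i ω)) ∂P := by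
          refine lintegral_congr fun ω => ?_
          rw [blockEnergy, Finset.sum_cons, mul_add, Real.exp_add,
            ENNReal.ofReal_mul (Real.exp_pos _).le, blockEnergy]
      _ = (∫⁻ ω, ENNReal.ofReal (Real.exp (l / v * ((∑ i ∈ B a, X i ω) ^ 2 / (B a).card))) ∂P) *
            ∫⁻ ω, ENNReal.ofReal (Real.exp (l / v * blockEnergy K B fun i => X i ω)) ∂P := by
          refine lintegral_mul_eq_lintegral_mul_lintegral_of_indepFun'' ?_ ?_ hi'
          · fun_prop
          · unfold blockEnergy
            fun_prop
      _ ≤ expSqMoment l * expSqMoment l ^ K.card :=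
          mul_le_mul' (lintegral_exp_sq_sum_div_card hl hv hlaw hindep _) (ih hB')
      _ = expSqMoment l ^ (Finset.cons a K ha).card := by
          rw [Finset.card_cons, pow_succ']

/-- Chernoff bound for the energy of the noise on disjoint blocks. -/
theorem measure_le_blockEnergy [IsProbabilityMeasure P] {l : ℝ} (hl : 0 < l) (hv : 0 < v)
    {I : Finset ℕ} {Z : ℕ → Ω → ℝ} (hlaw : ∀ t ∈ I, HasLaw (Z t) (gaussianReal 0 v) P)
    (hindep : iIndepFun (fun t : I => Z t) P)
    {K : Finset κ} {B : κ → Finset ℕ} (hB : (K : Set κ).PairwiseDisjoint B)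
    (hBI : ∀ k ∈ K, B k ⊆ I) (x : ℝ) :
    P {ω | x ≤ blockEnergy K B fun t => Z t ω} ≤
      expSqMoment l ^ K.card * ENNReal.ofReal (Real.exp (-(l / v * x))) := by
  have hv' : (0 : ℝ) < v := hv
  have hB' : (K : Set κ).PairwiseDisjoint fun k => (B k).subtype (· ∈ I) := by
    intro i hi j hj hij
    rw [Function.onFun, Finset.disjoint_left]
    intro t ht ht'
    exact Finset.disjoint_left.1 (hB hi hj hij) (Finset.mem_subtype.1 ht) (Finset.mem_subtype.1 ht')
  have h := lintegral_exp_blockEnergy_le hl.le hv (X := fun t : I => Z t) (fun t => hlaw t t.2)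
    hindep K hB'
  have e : ∀ ω, blockEnergy K (fun k => (B k).subtype (· ∈ I)) (fun t : I => Z t ω) =
      blockEnergy K B fun t => Z t ω := fun ω => blockEnergy_subtype hBI fun t => Z t ω
  simp only [e] at h
  have hmeas : AEMeasurable (fun ω => ENNReal.ofReal (Real.exp (l / v *
      blockEnergy K B fun t => Z t ω))) P := by
    simp only [← e]
    have : ∀ t : I, AEMeasurable (Z t) P := fun t => (hlaw t t.2).aemeasurable
    unfold blockEnergy
    fun_prop
  have hmarkov := mul_meas_ge_le_lintegral₀ hmeas (ENNReal.ofReal (Real.exp (l / v * x)))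
  have hset : {ω | x ≤ blockEnergy K B fun t => Z t ω} ⊆ {ω | ENNReal.ofReal (Real.exp (l / v * x)) ≤
      ENNReal.ofReal (Real.exp (l / v * blockEnergy K B fun t => Z t ω))} := fun ω hω =>
    ENNReal.ofReal_le_ofReal (Real.exp_le_exp.2 (mul_le_mul_of_nonneg_left hω (by positivity)))
  have hone : ENNReal.ofReal (Real.exp (-(l / v * x))) * ENNReal.ofReal (Real.exp (l / v * x)) = 1 := by
    rw [← ENNReal.ofReal_mul (Real.exp_pos _).le, ← Real.exp_add]
    simp
  calc P {ω | x ≤ blockEnergy K B fun t => Z t ω}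
      = ENNReal.ofReal (Real.exp (-(l / v * x))) * (ENNReal.ofReal (Real.exp (l / v * x)) *
          P {ω | x ≤ blockEnergy K B fun t => Z t ω}) := by rw [← mul_assoc, hone, one_mul]
    _ ≤ ENNReal.ofReal (Real.exp (-(l / v * x))) * expSqMoment l ^ K.card := by
        gcongr
        exact (mul_le_mul_right (measure_mono hset) _).trans (hmarkov.trans h)
    _ = _ := mul_comm _ _

end Noise

/-! ### Optimal segmentations of a noisy step function -/

/-- The penalised cost of `y 1, …, y n` at the changepoints `S` is at most that at any
`S' ⊆ {1, …, n - 1}`. The penalty is `#S * β`: the constant contribution of the last segment is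
dropped. That `S` itself lies in `{1, …, n - 1}` is not part of the definition. -/
def IsOptimal (n : ℕ) (y : ℕ → ℝ) (β : ℝ) (S : Finset ℕ) : Prop :=
  ∀ S' ⊆ Finset.Ioo 0 n, rss (Finset.Icc 1 n) y (segmentLabel S) + S.card * β ≤
    rss (Finset.Icc 1 n) y (segmentLabel S') + S'.card * β

theorem IsPELTOutput.isOptimal {n : ℕ} {y : ℕ → ℝ} {β : ℝ} {s : Segmentation n}
    (h : IsPELTOutput y β s) : IsOptimal n y β s.toFinset := by
  intro S' hS'
  obtain ⟨s', rfl⟩ := exists_segmentation_toFinset hS'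
  have := h s'
  rw [penalisedCost_eq_rss, penalisedCost_eq_rss] at this
  linarith

theorem sum_sq_sub_const_ge {F : Finset ℕ} (z : ℕ → ℝ) (p c η : ℝ)
    (h : |∑ t ∈ F, z t| ≤ η * F.card) :
    ∑ t ∈ F, z t ^ 2 + F.card * (|p - c| ^ 2 - 2 * η * |p - c|) ≤
      ∑ t ∈ F, (z t + p - c) ^ 2 := by
  have e : ∑ t ∈ F, (z t + p - c) ^ 2 =
      ∑ t ∈ F, z t ^ 2 + 2 * ((p - c) * ∑ t ∈ F, z t) + F.card * (p - c) ^ 2 := by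
    rw [Finset.mul_sum, Finset.mul_sum, ← nsmul_eq_mul, ← Finset.sum_const,
      ← Finset.sum_add_distrib, ← Finset.sum_add_distrib]
    exact Finset.sum_congr rfl fun t _ => by ring
  have h1 : |(p - c) * ∑ t ∈ F, z t| ≤ |p - c| * (η * F.card) := by
    rw [abs_mul]
    exact mul_le_mul_of_nonneg_left h (abs_nonneg _)
  have h2 := (abs_le.1 h1).1
  rw [e, sq_abs]
  linarith

/-- An optimal segmentation has a changepoint within distance `R` of each jump of the signal:
otherwise adding `τ - R`, `τ` and `τ + R` would decrease the loss by more than `3 * β`. -/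
theorem IsOptimal.exists_near {n : ℕ} {z f : ℕ → ℝ} {β : ℝ} {S : Finset ℕ} (hβ : 0 ≤ β)
    (hopt : IsOptimal n (fun t => z t + f t) β S) (hS : S ⊆ Finset.Ioo 0 n)
    {τ R : ℕ} (hR : 0 < R) (hRτ : R < τ) (hτn : τ + R < n) {p q : ℝ}
    (hp : ∀ t ∈ Finset.Ioc (τ - R) τ, f t = p) (hq : ∀ t ∈ Finset.Ioc τ (τ + R), f t = q)
    (hzp : |∑ t ∈ Finset.Ioc (τ - R) τ, z t| ≤ |p - q| / 8 * R)
    (hzq : |∑ t ∈ Finset.Ioc τ (τ + R), z t| ≤ |p - q| / 8 * R)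
    (hgain : 3 * β < R * |p - q| ^ 2 / 4) :
    ∃ x ∈ S, τ - R ≤ x ∧ x ≤ τ + R := by
  by_contra! hcon
  set L := Finset.Ioc (τ - R) τ with hL
  set M := Finset.Ioc τ (τ + R) with hM
  set I := Finset.Icc 1 n with hI
  set y : ℕ → ℝ := fun t => z t + f t with hy
  have hLI : L ⊆ I := fun t ht => by
    simp only [hL, hI, Finset.mem_Ioc, Finset.mem_Icc] at ht ⊢; omega
  have hMI : M ⊆ I \ L := fun t ht => by
    simp only [hL, hM, hI, Finset.mem_sdiff, Finset.mem_Ioc, Finset.mem_Icc] at ht ⊢; omega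
  have hLcard : L.card = R := by rw [hL, Nat.card_Ioc]; omega
  have hMcard : M.card = R := by rw [hM, Nat.card_Ioc]; omega
  set S' := insert (τ - R) (insert τ (insert (τ + R) S)) with hS'
  have hS'n : S' ⊆ Finset.Ioo 0 n := by
    intro x hx
    simp only [hS', Finset.mem_insert] at hx
    rcases hx with rfl | rfl | rfl | hx
    · rw [Finset.mem_Ioo]; omega
    · rw [Finset.mem_Ioo]; omega
    · rw [Finset.mem_Ioo]; omega
    · exact hS hx
  have hcard : (S'.card : ℝ) ≤ S.card + 3 := by
    have h1 := Finset.card_insert_le (τ - R) (insert τ (insert (τ + R) S))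
    have h2 := Finset.card_insert_le τ (insert (τ + R) S)
    have h3 := Finset.card_insert_le (τ + R) S
    have h4 : S'.card ≤ S.card + 3 := h1.trans (by omega)
    exact_mod_cast h4
  have hle := hopt S' hS'n
  have hβ' : S'.card * β ≤ (S.card + 3) * β := mul_le_mul_of_nonneg_right hcard hβ
  -- The fit of `S` is a constant `c` on the window `(τ - R, τ + R]`.
  set g : ℕ → ℝ := fun t => (∑ u ∈ I with segmentLabel S u = segmentLabel S t, y u) /
    (I.filter fun u => segmentLabel S u = segmentLabel S t).card with hg
  have hgc : ∀ t u, segmentLabel S t = segmentLabel S u → g t = g u := fun t u h => by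
    simp only [hg, h]
  have hwin : ∀ t, τ - R < t → t ≤ τ + R → g t = g τ := fun t h1 h2 =>
    hgc _ _ (segmentLabel_eq_iff.2 fun x hx => by
      have := hcon x hx
      omega)
  set c := g τ with hc
  -- The competitor replaces this constant by the true levels.
  set h : ℕ → ℝ := fun t => if t ∈ L then p else if t ∈ M then q else g t with hh
  have hcomp : rss I y (segmentLabel S') ≤ ∑ t ∈ I, (y t - h t) ^ 2 := by
    refine rss_le_sum_sq y fun t _ u _ htu => ?_
    have key := segmentLabel_eq_iff.1 htu
    have k1 := key (τ - R) (by simp [hS'])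
    have k2 := key τ (by simp [hS'])
    have k3 := key (τ + R) (by simp [hS'])
    have k4 : g t = g u := hgc _ _ (segmentLabel_eq_iff.2 fun x hx => key x (by simp [hS', hx]))
    have eL : t ∈ L ↔ u ∈ L := by simp only [hL, Finset.mem_Ioc]; omega
    have eM : t ∈ M ↔ u ∈ M := by simp only [hM, Finset.mem_Ioc]; omega
    simp only [hh, eL, eM, k4]
  have split : ∀ F : ℕ → ℝ, ∑ t ∈ I, F t = ∑ t ∈ (I \ L) \ M, F t + ∑ t ∈ M, F t + ∑ t ∈ L, F t :=
    fun F => by rw [Finset.sum_sdiff hMI, Finset.sum_sdiff hLI]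
  have hrest : ∑ t ∈ (I \ L) \ M, (y t - h t) ^ 2 = ∑ t ∈ (I \ L) \ M, (y t - g t) ^ 2 :=
    Finset.sum_congr rfl fun t ht => by
      simp only [Finset.mem_sdiff] at ht
      simp only [hh, ht.1.2, ht.2, if_false]
  have hhL : ∑ t ∈ L, (y t - h t) ^ 2 = ∑ t ∈ L, z t ^ 2 :=
    Finset.sum_congr rfl fun t ht => by
      simp only [hh, ht, if_true, hy, hp t ht]; ring
  have hhM : ∑ t ∈ M, (y t - h t) ^ 2 = ∑ t ∈ M, z t ^ 2 :=
    Finset.sum_congr rfl fun t ht => by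
      have : t ∉ L := (Finset.mem_sdiff.1 (hMI ht)).2
      simp only [hh, ht, this, if_true, if_false, hy, hq t ht]; ring
  have hgL : ∑ t ∈ L, (y t - g t) ^ 2 = ∑ t ∈ L, (z t + p - c) ^ 2 :=
    Finset.sum_congr rfl fun t ht => by
      have h' := Finset.mem_Ioc.1 ht
      simp only [hy, hp t ht, hwin t h'.1 (by omega)]
  have hgM : ∑ t ∈ M, (y t - g t) ^ 2 = ∑ t ∈ M, (z t + q - c) ^ 2 :=
    Finset.sum_congr rfl fun t ht => by
      have h' := Finset.mem_Ioc.1 ht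
      simp only [hy, hq t ht, hwin t (by omega) h'.2]
  have bL := sum_sq_sub_const_ge (F := L) z p c (|p - q| / 8) (by rw [hLcard]; exact hzp)
  have bM := sum_sq_sub_const_ge (F := M) z q c (|p - q| / 8) (by rw [hMcard]; exact hzq)
  rw [hLcard] at bL
  rw [hMcard] at bM
  have hfit : rss I y (segmentLabel S) = ∑ t ∈ I, (y t - g t) ^ 2 := rfl
  rw [split, hgL, hgM] at hfit
  rw [split, hrest, hhL, hhM] at hcomp
  have htri : |p - q| ≤ |p - c| + |q - c| := by
    have := abs_sub (p - c) (q - c)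
    simpa using this
  have hR' : (0 : ℝ) ≤ R := Nat.cast_nonneg _
  -- `a ^ 2 + b ^ 2 - (a + b) * d / 4 ≥ d ^ 2 / 4` whenever `a + b ≥ d ≥ 0`
  have hquad : |p - q| ^ 2 / 4 ≤ (|p - c| ^ 2 - 2 * (|p - q| / 8) * |p - c|) +
      (|q - c| ^ 2 - 2 * (|p - q| / 8) * |q - c|) := by
    nlinarith [sq_nonneg (|p - c| - |q - c|), abs_nonneg (p - q),
      mul_nonneg (sub_nonneg.2 htri) (abs_nonneg (p - q)), sq_nonneg (|p - c| + |q - c| - |p - q|)]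
  have := mul_le_mul_of_nonneg_left hquad hR'
  linarith

/-- The changepoints of an optimal segmentation in excess of the true number are paid for by the
energy that the noise gains on the common refinement with the true segmentation. -/
theorem IsOptimal.excess_mul_le_blockEnergy {n m : ℕ} {z : ℕ → ℝ} {β : ℝ} {S : Finset ℕ}
    (hβ : 0 ≤ β) {μ : Fin (m + 1) → ℝ} {τ : Fin m → ℕ}
    (hopt : IsOptimal n (fun t => z t + signal μ τ t) β S) (hτ : ∀ i, τ i ∈ Finset.Ioo 0 n)
    {U K : Finset ℕ} (hSU : S ⊆ U) (hτU : ∀ i, τ i ∈ U) (hUK : ∀ t, segmentLabel U t ∈ K) :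
    ((S.card : ℝ) - m) * β ≤
      blockEnergy K (fun k => (Finset.Icc 1 n).filter fun t => segmentLabel U t = k) z := by
  have h := hopt (Finset.univ.image τ) (by
    intro x hx
    obtain ⟨i, -, rfl⟩ := Finset.mem_image.1 hx
    exact hτ i)
  have hcard : ((Finset.univ.image τ).card : ℝ) ≤ m := by
    exact_mod_cast Finset.card_image_le.trans (Finset.card_fin m).le
  have hβ' := mul_le_mul_of_nonneg_right hcard hβ
  have h1 := rss_le_sum_sq (I := Finset.Icc 1 n) (fun t => z t + signal μ τ t)
    (c := segmentLabel (Finset.univ.image τ)) (h := signal μ τ) fun t _ u _ htu =>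
      signal_eq_of_segmentLabel_eq μ (by simp) htu
  simp only [add_sub_cancel_right] at h1
  have h2 := rss_segmentLabel_anti (Finset.Icc 1 n) (fun t => z t + signal μ τ t) hSU
  rw [rss_add z fun t _ u _ htu => signal_eq_of_segmentLabel_eq μ hτU htu,
    rss_eq_sub_blockEnergy z fun t _ => hUK t] at h2
  linarith

/-- A set of `m` changepoints, with one near each `τ i`, is an accurate segmentation. -/
theorem accurate_of_near {n m R : ℕ} {τ : Fin m → ℕ} {s : Segmentation n}
    (hsep : ∀ i j, i < j → τ i + 2 * R < τ j) {a : Fin m → ℕ} (haS : ∀ i, a i ∈ s.toFinset)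
    (ha : ∀ i, τ i - R ≤ a i ∧ a i ≤ τ i + R) (hcard : s.toFinset.card = m) {r : ℤ}
    (hr : (R : ℤ) ≤ r) : Accurate τ r s := by
  rw [s.card_toFinset] at hcard
  refine ⟨hcard.symm, fun i => ?_⟩
  obtain ⟨k, loc, hmono, hpos, hlt⟩ := s
  subst hcard
  have hamono : StrictMono a := fun i j hij => by
    have := hsep i j hij
    have := ha i
    have := ha j
    omega
  have hsub : Finset.univ.image a ⊆ Finset.univ.image loc := fun x hx => by
    obtain ⟨i, -, rfl⟩ := Finset.mem_image.1 hx
    exact haS i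
  have heq := Finset.eq_of_subset_of_card_le hsub (by
    rw [Finset.card_image_of_injective _ hmono.injective,
      Finset.card_image_of_injective _ hamono.injective])
  have hal : a = loc := (hamono.range_inj hmono).1 (by
    simpa [← Finset.coe_inj] using heq)
  have := ha i
  rw [hal] at this
  show |((loc i : ℕ) : ℤ) - (τ i : ℤ)| ≤ r
  rw [abs_le]
  omega

/-! ### The good event -/

section Signal

variable {m R : ℕ} {τ : Fin m → ℕ}

theorem signal_eq_castSucc (μ : Fin (m + 1) → ℝ) (hsep : ∀ i j, i < j → τ i + 2 * R < τ j)
    (i : Fin m) {t : ℕ} (ht : t ∈ Finset.Ioc (τ i - R) (τ i)) : signal μ τ t = μ i.castSucc := by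
  rw [Finset.mem_Ioc] at ht
  have hf : (Finset.univ.filter fun j => τ j < t) = Finset.Iio i := by
    ext j
    simp only [Finset.mem_filter, Finset.mem_univ, true_and, Finset.mem_Iio]
    rcases lt_trichotomy j i with h | rfl | h
    · have := hsep j i h
      simp only [h, iff_true]; omega
    · simp only [lt_irrefl, iff_false]; omega
    · have := hsep i j h
      simp only [h.not_gt, iff_false]; omega
  unfold signal
  congr 1
  apply Fin.ext
  simp [hf]

theorem signal_eq_succ (μ : Fin (m + 1) → ℝ) (hsep : ∀ i j, i < j → τ i + 2 * R < τ j)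
    (i : Fin m) {t : ℕ} (ht : t ∈ Finset.Ioc (τ i) (τ i + R)) : signal μ τ t = μ i.succ := by
  rw [Finset.mem_Ioc] at ht
  have hf : (Finset.univ.filter fun j => τ j < t) = Finset.Iic i := by
    ext j
    simp only [Finset.mem_filter, Finset.mem_univ, true_and, Finset.mem_Iic]
    rcases lt_trichotomy j i with h | rfl | h
    · have := hsep j i h
      simp only [h.le, iff_true]; omega
    · simp only [le_refl, iff_true]; omega
    · have := hsep i j h
      simp only [h.not_ge, iff_false]; omega
  unfold signal
  congr 1
  apply Fin.ext
  simp [hf]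

/-- Deterministic part of consistency: if the noise sums on the windows of length `R` on both sides
of each changepoint are small, and no set `B` of spurious changepoints is worth its penalty `#B * β`
even after joining the true changepoints and one point near each of them, then all optimal
segmentations are accurate. -/
theorem accurate_of_noise_bounds {n : ℕ} {z : ℕ → ℝ} {β : ℝ} (hβ : 0 ≤ β)
    {μ : Fin (m + 1) → ℝ} (hR : 0 < R) (hsep : ∀ i j, i < j → τ i + 2 * R < τ j)
    (hτR : ∀ i, R < τ i) (hτn : ∀ i, τ i + R < n)
    (hgain : ∀ i : Fin m, 3 * β < R * |μ i.castSucc - μ i.succ| ^ 2 / 4)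
    (hleft : ∀ i : Fin m, |∑ t ∈ Finset.Ioc (τ i - R) (τ i), z t| ≤
      |μ i.castSucc - μ i.succ| / 8 * R)
    (hright : ∀ i : Fin m, |∑ t ∈ Finset.Ioc (τ i) (τ i + R), z t| ≤
      |μ i.castSucc - μ i.succ| / 8 * R)
    (henergy : ∀ a ∈ Fintype.piFinset fun i => Finset.Icc (τ i - R) (τ i + R),
      ∀ B ∈ (Finset.Ioo 0 n).powerset.erase ∅,
      blockEnergy (Finset.range (2 * m + 1 + B.card)) (fun k => (Finset.Icc 1 n).filter fun t =>
        segmentLabel (Finset.univ.image τ ∪ (Finset.univ.image a ∪ B)) t = k) z < B.card * β)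
    {s : Segmentation n} (hs : IsPELTOutput (fun t => z t + signal μ τ t) β s) {r : ℤ}
    (hr : (R : ℤ) ≤ r) : Accurate τ r s := by
  have hopt := hs.isOptimal
  have hnear : ∀ i, ∃ x ∈ s.toFinset, τ i - R ≤ x ∧ x ≤ τ i + R := fun i =>
    hopt.exists_near hβ s.toFinset_subset hR (hτR i) (hτn i)
      (fun t ht => signal_eq_castSucc μ hsep i ht) (fun t ht => signal_eq_succ μ hsep i ht)
      (hleft i) (hright i) (hgain i)
  choose a haS ha using hnear
  have hainj : Function.Injective a := by
    refine StrictMono.injective fun i j hij => ?_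
    have := hsep i j hij
    have := ha i
    have := ha j
    omega
  set A := Finset.univ.image a with hA
  have hAcard : A.card = m := by rw [hA, Finset.card_image_of_injective _ hainj, Finset.card_fin]
  have hAS : A ⊆ s.toFinset := fun x hx => by
    obtain ⟨i, -, rfl⟩ := Finset.mem_image.1 hx
    exact haS i
  refine accurate_of_near hsep haS ha ?_ hr
  by_contra hne
  set B := s.toFinset \ A with hB
  have hBcard : B.card + m = s.toFinset.card := by
    rw [← hAcard]
    exact Finset.card_sdiff_add_card_eq_card hAS
  have hBmem : B ∈ (Finset.Ioo 0 n).powerset.erase ∅ := by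
    rw [Finset.mem_erase, Finset.mem_powerset, ← Finset.nonempty_iff_ne_empty, ← Finset.card_ne_zero]
    exact ⟨by omega, Finset.sdiff_subset.trans s.toFinset_subset⟩
  have h1 := henergy a (Fintype.mem_piFinset.2 fun i => Finset.mem_Icc.2 (ha i)) B hBmem
  set U := Finset.univ.image τ ∪ (A ∪ B) with hU
  have hUcard : U.card ≤ 2 * m + B.card := by
    have h1 := Finset.card_union_le (Finset.univ.image τ) (A ∪ B)
    have h2 := Finset.card_union_le A B
    have h3 : (Finset.univ.image τ).card ≤ m := Finset.card_image_le.trans (Finset.card_fin m).le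
    exact h1.trans (by omega)
  have h2 := hopt.excess_mul_le_blockEnergy hβ
    (fun i => Finset.mem_Ioo.2 ⟨by have := hτR i; omega, by have := hτn i; omega⟩) (U := U)
    (K := Finset.range (2 * m + 1 + B.card))
    (fun x hx => by
      by_cases hxA : x ∈ A
      · simp [hU, hxA]
      · simp [hU, hB, hx])
    (fun i => by simp [hU])
    (fun t => Finset.mem_range.2 (by have := segmentLabel_le_card U t; omega))
  rw [← hBcard] at h2
  push_cast at h2
  rw [add_sub_cancel_right] at h2
  linarith

end Signal

/-! ### Union bounds -/

section Noise

variable {Ω : Type*} [MeasurableSpace Ω] {P : Measure Ω} [IsProbabilityMeasure P] {v : ℝ≥0}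
  {I : Finset ℕ} {Z : ℕ → Ω → ℝ} {l : ℝ}

theorem measure_le_blockEnergy_ofReal {κ : Type*} (hl : 0 < l) (hl' : l < 1 / 2) (hv : 0 < v)
    (hlaw : ∀ t ∈ I, HasLaw (Z t) (gaussianReal 0 v) P) (hindep : iIndepFun (fun t : I => Z t) P)
    {K : Finset κ} {B : κ → Finset ℕ} (hB : (K : Set κ).PairwiseDisjoint B)
    (hBI : ∀ k ∈ K, B k ⊆ I) (x : ℝ) :
    P {ω | x ≤ blockEnergy K B fun t => Z t ω} ≤
      ENNReal.ofReal ((expSqMoment l).toReal ^ K.card * Real.exp (-(l / v * x))) := by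
  refine (measure_le_blockEnergy hl hv hlaw hindep hB hBI x).trans_eq ?_
  rw [ENNReal.ofReal_mul (by positivity), ENNReal.ofReal_pow ENNReal.toReal_nonneg,
    ENNReal.ofReal_toReal (expSqMoment_ne_top hl')]

theorem measure_lt_abs_sum (hl : 0 < l) (hl' : l < 1 / 2) (hv : 0 < v)
    (hlaw : ∀ t ∈ I, HasLaw (Z t) (gaussianReal 0 v) P) (hindep : iIndepFun (fun t : I => Z t) P)
    {F : Finset ℕ} (hF : F ⊆ I) {R : ℕ} (hFR : F.card = R) {η : ℝ} (hη : 0 ≤ η) :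
    P {ω | η * R < |∑ t ∈ F, Z t ω|} ≤
      ENNReal.ofReal ((expSqMoment l).toReal * Real.exp (-(l / v * (η ^ 2 * R)))) := by
  have h := measure_le_blockEnergy_ofReal hl hl' hv hlaw hindep (K := {()}) (B := fun _ => F)
    (by simp) (fun _ _ => hF) (η ^ 2 * R)
  rw [Finset.card_singleton, pow_one] at h
  refine (measure_mono fun ω hω => ?_).trans h
  rw [Set.mem_ofPred_eq] at hω ⊢
  rw [blockEnergy, Finset.sum_singleton, hFR]
  rcases Nat.eq_zero_or_pos R with rfl | hR
  · simp
  · have hR' : (0 : ℝ) < R := by exact_mod_cast hR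
    rw [le_div_iff₀ hR', ← sq_abs (∑ t ∈ F, Z t ω)]
    calc η ^ 2 * R * R = (η * R) ^ 2 := by ring
      _ ≤ _ := pow_le_pow_left₀ (by positivity) hω.le 2

theorem sum_powerset_erase_empty {n : ℕ} (c w : ℝ) (k : ℕ) :
    ∑ B ∈ (Finset.Ioo 0 n).powerset.erase ∅, c ^ k * w ^ B.card = c ^ k * ((w + 1) ^ (n - 1) - 1) := by
  rw [← Finset.mul_sum]
  congr 1
  have h := Finset.sum_pow_mul_eq_add_pow w 1 (Finset.Ioo 0 n)
  rw [← Finset.add_sum_erase _ _ (Finset.empty_mem_powerset _)] at h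
  simp only [one_pow, mul_one, Finset.card_empty, pow_zero, Nat.card_Ioo, Nat.sub_zero] at h
  linarith

/-- Union bound over the nonempty sets `B` of spurious changepoints and the positions `a` of the
changepoints near the true ones. Only the former cost a factor `n` per changepoint, which is
compensated by `exp (-l * β / v)`. -/
theorem measure_exists_le_blockEnergy {m n R : ℕ} {τ : Fin m → ℕ} {β : ℝ} (hl : 0 < l)
    (hl' : l < 1 / 2) (hv : 0 < v)
    (hlaw : ∀ t ∈ Finset.Icc 1 n, HasLaw (Z t) (gaussianReal 0 v) P)
    (hindep : iIndepFun (fun t : Finset.Icc 1 n => Z t) P)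
    (hsmall : n * ((expSqMoment l).toReal * Real.exp (-(l / v * β))) ≤ 1) :
    P {ω | ∃ a ∈ Fintype.piFinset fun i => Finset.Icc (τ i - R) (τ i + R),
      ∃ B ∈ (Finset.Ioo 0 n).powerset.erase ∅,
      B.card * β ≤ blockEnergy (Finset.range (2 * m + 1 + B.card)) (fun k =>
        (Finset.Icc 1 n).filter fun t =>
          segmentLabel (Finset.univ.image τ ∪ (Finset.univ.image a ∪ B)) t = k) fun t => Z t ω} ≤
      ENNReal.ofReal ((2 * R + 1) ^ m * ((expSqMoment l).toReal ^ (2 * m + 1) *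
        (2 * (n * ((expSqMoment l).toReal * Real.exp (-(l / v * β))))))) := by
  set c := (expSqMoment l).toReal with hc
  set w := c * Real.exp (-(l / v * β)) with hw
  have hc0 : 0 ≤ c := ENNReal.toReal_nonneg
  have hw0 : 0 ≤ w := by positivity
  have hone : ∀ (a : Fin m → ℕ) (B : Finset ℕ),
      P {ω | B.card * β ≤ blockEnergy (Finset.range (2 * m + 1 + B.card)) (fun k =>
        (Finset.Icc 1 n).filter fun t =>
          segmentLabel (Finset.univ.image τ ∪ (Finset.univ.image a ∪ B)) t = k) fun t => Z t ω} ≤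
      ENNReal.ofReal (c ^ (2 * m + 1) * w ^ B.card) := by
    intro a B
    refine (measure_le_blockEnergy_ofReal hl hl' hv hlaw hindep ?_
      (fun k _ => Finset.filter_subset _ _) _).trans_eq ?_
    · intro i _ j _ hij
      rw [Function.onFun, Finset.disjoint_filter]
      rintro t - rfl
      exact hij
    · rw [Finset.card_range, pow_add, hw, mul_pow, ← Real.exp_nat_mul, mul_assoc]
      congr 4
      ring
  have hpi : ((Fintype.piFinset fun i => Finset.Icc (τ i - R) (τ i + R)).card : ℝ) ≤
      (2 * R + 1) ^ m := by
    rw [Fintype.card_piFinset]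
    push_cast
    calc ∏ i, ((Finset.Icc (τ i - R) (τ i + R)).card : ℝ) ≤ ∏ _i : Fin m, (2 * (R : ℝ) + 1) := by
          refine Finset.prod_le_prod (fun _ _ => Nat.cast_nonneg _) fun i _ => ?_
          have : (Finset.Icc (τ i - R) (τ i + R)).card ≤ 2 * R + 1 := by
            rw [Nat.card_Icc]; omega
          exact_mod_cast this
      _ = _ := by simp
  have hsum : ∑ B ∈ (Finset.Ioo 0 n).powerset.erase ∅, c ^ (2 * m + 1) * w ^ B.card ≤
      c ^ (2 * m + 1) * (2 * (n * w)) := by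
    rw [sum_powerset_erase_empty]
    refine mul_le_mul_of_nonneg_left ?_ (by positivity)
    have h1 : (w + 1) ^ (n - 1) ≤ Real.exp (n * w) := by
      calc (w + 1) ^ (n - 1) ≤ (w + 1) ^ n := pow_le_pow_right₀ (by linarith) (Nat.sub_le _ _)
        _ ≤ Real.exp w ^ n := pow_le_pow_left₀ (by linarith) (Real.add_one_le_exp w) n
        _ = Real.exp (n * w) := (Real.exp_nat_mul w n).symm
    have hnw : 0 ≤ n * w := by positivity
    have h2 := Real.abs_exp_sub_one_le (x := n * w) (by rwa [abs_of_nonneg hnw])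
    rw [abs_of_nonneg hnw] at h2
    linarith [le_abs_self (Real.exp (n * w) - 1)]
  have hset : ∀ (p : (Fin m → ℕ) → Finset ℕ → Ω → Prop) (s : Finset (Fin m → ℕ))
      (b : Finset (Finset ℕ)), {ω | ∃ a ∈ s, ∃ B ∈ b, p a B ω} =
        ⋃ a ∈ s, ⋃ B ∈ b, {ω | p a B ω} := by
    intro p s b
    ext ω
    simp
  rw [hset]
  calc _ ≤ ∑ a ∈ Fintype.piFinset fun i => Finset.Icc (τ i - R) (τ i + R),
        ∑ B ∈ (Finset.Ioo 0 n).powerset.erase ∅, ENNReal.ofReal (c ^ (2 * m + 1) * w ^ B.card) :=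
        (measure_biUnion_finset_le _ _).trans (Finset.sum_le_sum fun a _ =>
          (measure_biUnion_finset_le _ _).trans (Finset.sum_le_sum fun B _ => hone a B))
    _ ≤ _ := by
        rw [← ENNReal.ofReal_sum_of_nonneg fun B _ => by positivity, Finset.sum_const,
          ← ENNReal.ofReal_nsmul, nsmul_eq_mul]
        refine ENNReal.ofReal_le_ofReal ?_
        exact mul_le_mul hpi hsum (Finset.sum_nonneg fun B _ => by positivity) (by positivity)

end Noise

/-! ### Asymptotics -/

/-- The accuracy `⌈(log n) ^ (1 + α)⌉`, as a natural number. -/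
noncomputable def logRadius (α : ℝ) (n : ℕ) : ℕ := ⌈Real.log n ^ (1 + α)⌉₊

theorem logRadius_cast (α : ℝ) (n : ℕ) : (logRadius α n : ℤ) = ⌈Real.log n ^ (1 + α)⌉ :=
  Int.natCast_ceil_eq_ceil (Real.rpow_nonneg (Real.log_natCast_nonneg n) _)

theorem tendsto_log_natCast : Tendsto (fun n : ℕ => Real.log n) atTop atTop :=
  Real.tendsto_log_atTop.comp tendsto_natCast_atTop_atTop

theorem tendsto_logRadius {α : ℝ} (hα : 0 < α) :
    Tendsto (fun n => (logRadius α n : ℝ)) atTop atTop :=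
  tendsto_atTop_mono (fun _ => Nat.le_ceil _)
    ((tendsto_rpow_atTop (by linarith : 0 < 1 + α)).comp tendsto_log_natCast)

theorem eventually_lt_logRadius_mul {α : ℝ} (hα : 0 < α) (b : ℝ) {d : ℝ} (hd : 0 < d) :
    ∀ᶠ n : ℕ in atTop, b * Real.log n < logRadius α n * d := by
  have h1 := ((tendsto_rpow_atTop hα).comp tendsto_log_natCast).eventually_gt_atTop (b / d)
  filter_upwards [h1, tendsto_log_natCast.eventually_gt_atTop 0] with n hn hlog
  have h2 : Real.log n ^ (1 + α) ≤ logRadius α n := Nat.le_ceil _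
  rw [Real.rpow_add hlog, Real.rpow_one] at h2
  have h3 : b < Real.log n ^ α * d := (div_lt_iff₀ hd).1 hn
  calc b * Real.log n < Real.log n ^ α * d * Real.log n := mul_lt_mul_of_pos_right h3 hlog
    _ = Real.log n * Real.log n ^ α * d := by ring
    _ ≤ logRadius α n * d := mul_le_mul_of_nonneg_right h2 hd.le

theorem tendsto_logRadius_div_rpow (α : ℝ) {s : ℝ} (hs : 0 < s) :
    Tendsto (fun n : ℕ => (2 * (logRadius α n : ℝ) + 1) / (n : ℝ) ^ s) atTop (𝓝 0) := by
  have h1 : Tendsto (fun n : ℕ => Real.log n ^ (1 + α) / (n : ℝ) ^ s) atTop (𝓝 0) :=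
    (isLittleO_log_rpow_rpow_atTop (1 + α) hs).tendsto_div_nhds_zero.comp
      tendsto_natCast_atTop_atTop
  have h2 : Tendsto (fun n : ℕ => (3 : ℝ) / (n : ℝ) ^ s) atTop (𝓝 0) :=
    ((tendsto_rpow_atTop hs).comp tendsto_natCast_atTop_atTop).const_div_atTop 3
  have h3 := (h1.const_mul 2).add h2
  rw [mul_zero, add_zero] at h3
  refine squeeze_zero (fun n => by positivity) (fun n => ?_) h3
  have hn : (0 : ℝ) ≤ (n : ℝ) ^ s := by positivity
  have hc : (logRadius α n : ℝ) < Real.log n ^ (1 + α) + 1 :=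
    Nat.ceil_lt_add_one (Real.rpow_nonneg (Real.log_natCast_nonneg n) _)
  rw [← mul_div_assoc, ← add_div]
  exact div_le_div_of_nonneg_right (by linarith) hn

theorem tendsto_logRadius_pow_mul (α : ℝ) (m : ℕ) {q : ℝ} (hq : 0 < q) :
    Tendsto (fun n : ℕ => (2 * (logRadius α n : ℝ) + 1) ^ m * (n : ℝ) ^ (-q)) atTop (𝓝 0) := by
  have hm : (0 : ℝ) < m + 1 := by positivity
  have hs : 0 < q / (m + 1) := div_pos hq hm
  have h1 := (tendsto_logRadius_div_rpow α hs).pow m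
  have h2 : Tendsto (fun n : ℕ => (n : ℝ) ^ (-(q / (m + 1)))) atTop (𝓝 0) :=
    (tendsto_rpow_neg_atTop hs).comp tendsto_natCast_atTop_atTop
  have h3 := h1.mul h2
  rw [mul_zero] at h3
  refine h3.congr' ?_
  filter_upwards [eventually_gt_atTop 0] with n hn
  have hn' : (0 : ℝ) < n := by exact_mod_cast hn
  rw [div_pow, div_mul_eq_mul_div, mul_div_assoc, ← Real.rpow_natCast ((n : ℝ) ^ _),
    ← Real.rpow_mul hn'.le, ← Real.rpow_sub hn']
  congr 2
  field_simp
  ring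

theorem natCast_mul_exp_neg_mul_log {n : ℕ} (hn : 0 < n) (p : ℝ) :
    (n : ℝ) * Real.exp (-(p * Real.log n)) = (n : ℝ) ^ (-(p - 1)) := by
  have hn' : (0 : ℝ) < n := by exact_mod_cast hn
  nth_rw 1 [← Real.exp_log hn']
  rw [Real.rpow_def_of_pos hn', ← Real.exp_add]
  congr 1
  ring

theorem tendsto_trueChange_div {m : ℕ} (θ : Fin m → ℝ) {i : Fin m} (hθ : 0 < θ i) :
    Tendsto (fun n : ℕ => (trueChange θ n i : ℝ) / n) atTop (𝓝 (θ i)) :=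
  (tendsto_nat_floor_mul_div_atTop hθ.le).comp tendsto_natCast_atTop_atTop

theorem eventually_trueChange_separated {m : ℕ} {θ : Fin m → ℝ} (hθ : StrictMono θ)
    (hθ0 : ∀ i, 0 < θ i) (hθ1 : ∀ i, θ i < 1) (α : ℝ) :
    ∀ᶠ n : ℕ in atTop, (∀ i j, i < j →
        trueChange θ n i + 2 * logRadius α n < trueChange θ n j) ∧
      (∀ i, logRadius α n < trueChange θ n i) ∧ ∀ i, trueChange θ n i + logRadius α n < n := by
  have hR := tendsto_logRadius_div_rpow α one_pos
  simp only [Real.rpow_one] at hR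
  have hsep : ∀ i j, ∀ᶠ n : ℕ in atTop, i < j →
      trueChange θ n i + 2 * logRadius α n < trueChange θ n j := by
    intro i j
    by_cases hij : i < j
    · have h := (tendsto_trueChange_div θ (hθ0 i)).add hR
      rw [add_zero] at h
      filter_upwards [h.eventually_lt (tendsto_trueChange_div θ (hθ0 j)) (hθ hij),
        eventually_gt_atTop 0] with n hn hn0 _
      have hn' : (0 : ℝ) < n := by exact_mod_cast hn0
      rw [← add_div, div_lt_div_iff_of_pos_right hn'] at hn
      have : trueChange θ n i + (2 * logRadius α n + 1) < trueChange θ n j := by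
        exact_mod_cast hn
      omega
    · exact Eventually.of_forall fun n h => absurd h hij
  have hlow : ∀ i, ∀ᶠ n : ℕ in atTop, logRadius α n < trueChange θ n i := by
    intro i
    filter_upwards [hR.eventually_lt (tendsto_trueChange_div θ (hθ0 i)) (hθ0 i),
      eventually_gt_atTop 0] with n hn hn0
    have hn' : (0 : ℝ) < n := by exact_mod_cast hn0
    rw [div_lt_div_iff_of_pos_right hn'] at hn
    have : 2 * logRadius α n + 1 < trueChange θ n i := by exact_mod_cast hn
    omega
  have hhigh : ∀ i, ∀ᶠ n : ℕ in atTop, trueChange θ n i + logRadius α n < n := by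
    intro i
    have h := (tendsto_trueChange_div θ (hθ0 i)).add hR
    rw [add_zero] at h
    filter_upwards [h.eventually_lt_const (hθ1 i), eventually_gt_atTop 0] with n hn hn0
    have hn' : (0 : ℝ) < n := by exact_mod_cast hn0
    rw [← add_div, div_lt_one hn'] at hn
    have : trueChange θ n i + (2 * logRadius α n + 1) < n := by exact_mod_cast hn
    omega
  exact (eventually_all.2 fun i => eventually_all.2 (hsep i)).and
    ((eventually_all.2 hlow).and (eventually_all.2 hhigh))

theorem tendsto_measure_one_of_compl_le {Ω : ℕ → Type*} [∀ n, MeasurableSpace (Ω n)]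
    (P : ∀ n, Measure (Ω n)) [∀ n, IsProbabilityMeasure (P n)] {A : ∀ n, Set (Ω n)} {δ : ℕ → ℝ≥0∞}
    (hδ : Tendsto δ atTop (𝓝 0)) (h : ∀ᶠ n in atTop, P n (A n)ᶜ ≤ δ n) :
    Tendsto (fun n => P n (A n)) atTop (𝓝 1) := by
  have h1 : Tendsto (fun n => 1 - δ n) atTop (𝓝 1) := by
    simpa using ENNReal.Tendsto.sub tendsto_const_nhds hδ (Or.inl ENNReal.one_ne_top)
  refine tendsto_of_tendsto_of_tendsto_of_le_of_le' h1 tendsto_const_nhds ?_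
    (Eventually.of_forall fun n => prob_le_one)
  filter_upwards [h] with n hn
  rw [tsub_le_iff_right]
  calc (1 : ℝ≥0∞) = P n Set.univ := measure_univ.symm
    _ = P n (A n ∪ (A n)ᶜ) := by rw [Set.union_compl_self]
    _ ≤ P n (A n) + P n (A n)ᶜ := measure_union_le _ _
    _ ≤ P n (A n) + δ n := by gcongr

end Changepoint

open Changepoint in
theorem proposition1
    -- number of changes, their relative positions, and the segment means
    (m : ℕ) (θ : Fin m → ℝ) (hθ : StrictMono θ) (hθ0 : ∀ i, 0 < θ i) (hθ1 : ∀ i, θ i < 1)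
    (μ : Fin (m + 1) → ℝ) (hμ : ∀ k : Fin m, μ k.castSucc ≠ μ k.succ)
    -- constant of the penalty, and variance of the noise
    (ε : ℝ) (hε : 0 < ε) (v : ℝ≥0) (hv0 : 0 < v) (hv : (v : ℝ) < 1 + ε / 2)
    -- for each `n`, the noise variables at times `1, …, n`
    {Ω : ℕ → Type*} [∀ n, MeasurableSpace (Ω n)] (P : ∀ n, Measure (Ω n))
    [∀ n, IsProbabilityMeasure (P n)] (Z : ∀ n, ℕ → Ω n → ℝ)
    (hZlaw : ∀ n, ∀ t ∈ Finset.Icc 1 n, HasLaw (Z n t) (gaussianReal 0 v) (P n))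
    (hZindep : ∀ n, iIndepFun (fun t : Finset.Icc 1 n => Z n t) (P n))
    (α : ℝ) (hα : 0 < α) :
    Tendsto
      (fun n : ℕ => P n {ω : Ω n | ∀ s : Changepoint.Segmentation n,
        Changepoint.IsPELTOutput
          (fun t => Z n t ω + Changepoint.signal μ (Changepoint.trueChange θ n) t)
          ((2 + ε) * Real.log n) s →
        Changepoint.Accurate (Changepoint.trueChange θ n) ⌈Real.log n ^ (1 + α)⌉ s})
      atTop (𝓝 1) := by
  have hv0' : (0 : ℝ) < v := hv0
  -- The Chernoff parameter `l < 1 / 2` is close enough to `1 / 2` for the exponent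
  -- `p = l * (2 + ε) / v` to exceed `1`; this is where `v < 1 + ε / 2` is used.
  obtain ⟨l, hl1, hl2⟩ : ∃ l, (v : ℝ) / (2 + ε) < l ∧ l < 1 / 2 :=
    exists_between (by rw [div_lt_iff₀ (by positivity)]; linarith)
  have hl : 0 < l := lt_trans (by positivity) hl1
  set p := l / v * (2 + ε) with hp
  have hp1 : 0 < p - 1 := by
    rw [div_lt_iff₀ (by positivity)] at hl1
    rw [hp, sub_pos, div_mul_eq_mul_div, one_lt_div hv0']
    exact hl1
  set c := (expSqMoment l).toReal with hc
  set R := logRadius α with hR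
  set d : Fin m → ℝ := fun i => |μ i.castSucc - μ i.succ| with hd
  have hd0 : ∀ i, 0 < d i := fun i => abs_pos.2 (sub_ne_zero.2 (hμ i))
  set δ₁ : ℕ → ℝ≥0∞ := fun n => ∑ i, ENNReal.ofReal
    (c * Real.exp (-(l / v * ((d i / 8) ^ 2 * R n)))) with hδ₁
  set δ₂ : ℕ → ℝ≥0∞ := fun n => ENNReal.ofReal ((2 * R n + 1) ^ m * (c ^ (2 * m + 1) *
    (2 * (n * (c * Real.exp (-(l / v * ((2 + ε) * Real.log n)))))))) with hδ₂
  have hpow : ∀ n : ℕ, 0 < n → (n : ℝ) * (c * Real.exp (-(l / v * ((2 + ε) * Real.log n)))) =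
      c * (n : ℝ) ^ (-(p - 1)) := fun n hn => by
    rw [← natCast_mul_exp_neg_mul_log hn, hp, mul_assoc (l / (v : ℝ))]
    ring
  have hδ₁0 : Tendsto δ₁ atTop (𝓝 0) := by
    rw [← Finset.sum_const_zero (s := (Finset.univ : Finset (Fin m)))]
    refine tendsto_finsetSum _ fun i _ => ?_
    rw [← ENNReal.ofReal_zero]
    refine (ENNReal.continuous_ofReal.tendsto 0).comp ?_
    have hk : 0 < l / v * (d i / 8) ^ 2 := by
      have := hd0 i
      positivity
    have h := (Real.tendsto_exp_neg_atTop_nhds_zero.comp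
      ((tendsto_logRadius hα).const_mul_atTop hk)).const_mul c
    rw [mul_zero] at h
    refine h.congr fun n => ?_
    simp only [Function.comp, hR]
    rw [mul_assoc (l / (v : ℝ))]
  have hδ₂0 : Tendsto δ₂ atTop (𝓝 0) := by
    rw [← ENNReal.ofReal_zero]
    refine (ENNReal.continuous_ofReal.tendsto 0).comp ?_
    have h := (tendsto_logRadius_pow_mul α m hp1).const_mul (c ^ (2 * m + 1) * 2 * c)
    rw [mul_zero] at h
    refine h.congr' ?_
    filter_upwards [eventually_gt_atTop 0] with n hn
    rw [hpow n hn]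
    ring
  have hsmall : ∀ᶠ n : ℕ in atTop,
      (n : ℝ) * (c * Real.exp (-(l / v * ((2 + ε) * Real.log n)))) ≤ 1 := by
    have h : Tendsto (fun n : ℕ => c * (n : ℝ) ^ (-(p - 1))) atTop (𝓝 (c * 0)) :=
      ((tendsto_rpow_neg_atTop hp1).comp tendsto_natCast_atTop_atTop).const_mul c
    rw [mul_zero] at h
    filter_upwards [h.eventually_le_const one_pos, eventually_gt_atTop 0] with n h1 hn
    rwa [hpow n hn]
  have hgain : ∀ᶠ n : ℕ in atTop, ∀ i,
      3 * (2 + ε) * Real.log n < R n * (d i ^ 2 / 4) :=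
    eventually_all.2 fun i => eventually_lt_logRadius_mul hα _ (by have := hd0 i; positivity)
  refine tendsto_measure_one_of_compl_le P (δ := fun n => δ₁ n + δ₁ n + δ₂ n)
    (by simpa using (hδ₁0.add hδ₁0).add hδ₂0) ?_
  filter_upwards [hsmall, hgain, eventually_trueChange_separated hθ hθ0 hθ1 α,
    (tendsto_logRadius hα).eventually_gt_atTop 0] with n hsmall hgain ⟨hsep, hlow, hhigh⟩ hR0
  set τ := trueChange θ n with hτ
  have hR0' : 0 < R n := by exact_mod_cast hR0
  have hleft : P n (⋃ i, {ω | d i / 8 * R n < |∑ t ∈ Finset.Ioc (τ i - R n) (τ i), Z n t ω|}) ≤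
      δ₁ n := by
    refine (measure_iUnion_fintype_le _ _).trans (Finset.sum_le_sum fun i _ => ?_)
    refine measure_lt_abs_sum hl hl2 hv0 (hZlaw n) (hZindep n) (fun t ht => ?_) ?_
      (by have := hd0 i; positivity)
    · have : τ i + R n < n := hhigh i
      rw [Finset.mem_Ioc] at ht
      rw [Finset.mem_Icc]; omega
    · have : R n < τ i := hlow i
      rw [Nat.card_Ioc]; omega
  have hright : P n (⋃ i, {ω | d i / 8 * R n < |∑ t ∈ Finset.Ioc (τ i) (τ i + R n), Z n t ω|}) ≤
      δ₁ n := by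
    refine (measure_iUnion_fintype_le _ _).trans (Finset.sum_le_sum fun i _ => ?_)
    refine measure_lt_abs_sum hl hl2 hv0 (hZlaw n) (hZindep n) (fun t ht => ?_) ?_
      (by have := hd0 i; positivity)
    · have : τ i + R n < n := hhigh i
      rw [Finset.mem_Ioc] at ht
      rw [Finset.mem_Icc]; omega
    · rw [Nat.card_Ioc]; omega
  have henergy := measure_exists_le_blockEnergy (m := m) (R := R n) (τ := τ) hl hl2 hv0 (hZlaw n)
    (hZindep n) hsmall
  refine le_trans (measure_mono ?_) ((measure_union_le _ _).trans (add_le_add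
    ((measure_union_le _ _).trans (add_le_add hleft hright)) henergy))
  rw [Set.compl_subset_comm]
  intro ω hω s hs
  simp only [Set.mem_compl_iff, Set.mem_union, Set.mem_iUnion, Set.mem_ofPred_eq, not_or,
    not_exists, not_lt, not_and, not_le] at hω
  obtain ⟨⟨hωl, hωr⟩, hωe⟩ := hω
  refine accurate_of_noise_bounds (z := fun t => Z n t ω) ?_ hR0' hsep hlow hhigh (fun i => ?_)
    hωl hωr hωe hs (logRadius_cast α n).le
  · exact mul_nonneg (by linarith) (Real.log_natCast_nonneg n)
  · have := hgain i
    simp only [hd] at this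
    linarith
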